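/- Let $r\ge 1$. A rider with $r$ basic moves is given by nonzero vectors $m_1,\dots,m_r\in\mathbb R^2$, no two of them parallel (in chess, integer vectors); a piece at $x$ attacks every point of its move lines $x+\mathbb R m_j$. Let $\mathcal B\subset\mathbb R^2$ be a board, that is, a closed convex polygon with nonempty interior $\mathcal B^\circ$. A nonattacking configuration of $3$ labelled copies of the piece on a dilation of $\mathcal B$ consists of points $p_1,p_2,p_3\in (n+1)\mathcal B^\circ\cap\mathbb Z^2$, for some integer $n\ge 0$, none of which lies on a move line of another. Its labelled combinatorial type records, for all $i\ne k$ and all $j$, whether $p_k$ is on the left or on the right side of the line $p_i+\mathbb R m_j$ oriented by $m_j$. Its unlabelled combinatorial type is the class of all labelled types obtained from this one by permuting the labels of the three pieces. (a) For every rider with $r$ basic moves and every board, the number of unlabelled combinatorial types of nonattacking configurations of $3$ copies on dilations of the board is $\frac13 r(r^2+3r-1)$. (b) The set of combinatorial types (labelled or unlabelled) depends only on $r$ and, up to reorientation, is independent of the move set and the board: for any two riders with $r$ basic moves and any two boards, one can list the moves of the first rider in a suitable order and replace some of the moves $m_j$ by $-m_j$, so that the set of types of the first rider on the first board becomes equal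 to that of the second rider on the second board. If the moves of both riders are already listed in counterclockwise order within an open half-turn (that is, $\det(m_i,m_j)>0$ for all $i<j$), then the two sets are equal. -/

import Mathlib

open scoped Pointwise

noncomputable section

/-- The signed area `det (u, v)` of two plane vectors. It is positive exactly when `v` points to
the left of the line through the origin oriented by `u`, negative exactly when it points to the
right, and zero exactly when `u` and `v` are parallel. -/
def cross (u v : ℝ × ℝ) : ℝ := u.1 * v.2 - u.2 * v.1

/-- A board: a closed convex polygon with nonempty interior. -/
def IsBoard (B : Set (ℝ × ℝ)) : Prop :=
  (∃ V : Finset (ℝ × ℝ), B = convexHull ℝ (V : Set (ℝ × ℝ))) ∧ (interior B).Nonempty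

/-- The working board of order `n`: the integral points in the interior of the board dilated by
the factor `n + 1`. -/
def workingBoard (B : Set (ℝ × ℝ)) (n : ℕ) : Set (ℝ × ℝ) :=
  (((n : ℝ) + 1) • interior B) ∩ {p | ∃ a b : ℤ, p = ((a : ℝ), (b : ℝ))}

/-- A move set of `r` basic moves: nonzero vectors, no two of them parallel, so that they span `r`
distinct move lines. The slopes need not be rational. -/
def IsMoveSet {r : ℕ} (M : Fin r → ℝ × ℝ) : Prop :=
  (∀ j, M j ≠ 0) ∧ ∀ i j, i ≠ j → ∀ t : ℝ, M j ≠ t • M i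

/-- A piece at `x` attacks the point `y` if `y` is on one of its move lines. -/
def Attacks {r : ℕ} (M : Fin r → ℝ × ℝ) (x y : ℝ × ℝ) : Prop :=
  ∃ j, ∃ t : ℝ, y - x = t • M j

/-- No piece lies on a move line of another piece. -/
def Nonattacking {r q : ℕ} (M : Fin r → ℝ × ℝ) (p : Fin q → ℝ × ℝ) : Prop :=
  ∀ i k, i ≠ k → ¬ Attacks M (p i) (p k)

/-- Labelled combinatorial types of `q` pieces with `r` basic moves: for each piece `i`, each move
`j` and each piece `k`, a side of the oriented move line of `i` in direction `j`. -/
abbrev LabelledType (r q : ℕ) : Type := Fin q → Fin r → Fin q → SignType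

/-- The labelled combinatorial type of a configuration: piece `k` is on the left (`1`) or on the
right (`-1`) of the `j`-th oriented move line of piece `i`. For `i = k` the value is always `0`
and carries no information. -/
def labelledType {r q : ℕ} (M : Fin r → ℝ × ℝ) (p : Fin q → ℝ × ℝ) : LabelledType r q :=
  fun i j k => SignType.sign (cross (M j) (p k - p i))

/-- The unlabelled type of a labelled type: the class of all labelled types that are obtained from
it by permuting the labels of the pieces. -/
def unlabelledClass {r q : ℕ} (T : LabelledType r q) : Set (LabelledType r q) :=
  {T' | ∃ s : Equiv.Perm (Fin q), ∀ i j k, T' i j k = T (s i) j (s k)}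

/-- The labelled combinatorial types of nonattacking configurations of `q` pieces on the dilations
of the board `B`. -/
def labelledTypes {r : ℕ} (M : Fin r → ℝ × ℝ) (B : Set (ℝ × ℝ)) (q : ℕ) :
    Set (LabelledType r q) :=
  {T | ∃ n : ℕ, ∃ p : Fin q → ℝ × ℝ,
    (∀ i, p i ∈ workingBoard B n) ∧ Nonattacking M p ∧ labelledType M p = T}

/-- The unlabelled combinatorial types of nonattacking configurations of `q` pieces on the
dilations of the board `B`. -/
def unlabelledTypes {r : ℕ} (M : Fin r → ℝ × ℝ) (B : Set (ℝ × ℝ)) (q : ℕ) :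
    Set (Set (LabelledType r q)) :=
  unlabelledClass '' labelledTypes M B q

/-- The move set `M` listed in the order `e` and with the moves of sign `-1` reversed. -/
def reorient {r : ℕ} (e : Equiv.Perm (Fin r)) (ε : Fin r → ℤˣ) (M : Fin r → ℝ × ℝ) :
    Fin r → ℝ × ℝ :=
  fun j => ((ε j : ℤ) : ℝ) • M (e j)

/-- The moves are listed in counterclockwise order and within an open half-turn. -/
def IsSorted {r : ℕ} (M : Fin r → ℝ × ℝ) : Prop :=
  ∀ i j, i < j → 0 < cross (M i) (M j)

end

open Filter Topology

/-! Shrinking a real configuration into the interior of the board, dilating and rounding to the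
lattice preserves strict signs. The board therefore plays no role: every nonattacking real
configuration contributes its type (`labelledType_mem_labelledTypes`).

For three pieces, the type amounts to the sectors of the three differences around the triangle,
among the `2 * r` open sectors cut out by the move lines through the origin. The differences sum to
zero, so no move line has all three strictly on one side. Conversely, this condition suffices to
find vectors of sum zero in three given sectors (`exists_sum_zero`).

It remains to count. A bad triple lies among `r` consecutive sectors and has a unique first sector,
which gives `2 * r * (r ^ 3 - (r - 1) ^ 3)` bad triples out of `(2 * r) ^ 3` and leaves `2 * r * (r
^ 2 + 3 * r - 1)`. Relabelling acts freely, so division by 6 gives (a). For sorted moves the sign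
vectors of the sectors depend only on `r` (`signVectors_eq_of_isSorted`), and every move set can be
sorted by a reorientation; this gives (b). -/

theorem cross_add (u v w : ℝ × ℝ) : cross u (v + w) = cross u v + cross u w := by
  simp [cross]; ring

theorem cross_smul (u : ℝ × ℝ) (t : ℝ) (v : ℝ × ℝ) : cross u (t • v) = t * cross u v := by
  simp [cross]; ring

theorem cross_neg (u v : ℝ × ℝ) : cross u (-v) = -cross u v := by
  simp [cross]; ring

theorem cross_sub (u v w : ℝ × ℝ) : cross u (v - w) = cross u v - cross u w := by
  simp [cross]; ring

theorem cross_smul_left (u : ℝ × ℝ) (t : ℝ) (v : ℝ × ℝ) : cross (t • u) v = t * cross u v := by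
  simp [cross]; ring

theorem cross_vector_self (u : ℝ × ℝ) : cross u u = 0 := by
  simp [cross]; ring

theorem cross_swap (u v : ℝ × ℝ) : cross v u = -cross u v := by
  simp [cross]; ring

theorem cross_eq_zero_iff {u : ℝ × ℝ} (hu : u ≠ 0) (v : ℝ × ℝ) :
    cross u v = 0 ↔ ∃ t : ℝ, v = t • u := by
  constructor
  · intro h
    simp only [cross] at h
    by_cases h1 : u.1 = 0
    · have h2 : u.2 ≠ 0 := fun h2 => hu (Prod.ext h1 h2)
      refine ⟨v.2 / u.2, Prod.ext ?_ ?_⟩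
      · have : v.1 = 0 := by simpa [h1, h2] using h
        simp [h1, this]
      · simp [h2]
    · refine ⟨v.1 / u.1, Prod.ext ?_ ?_⟩
      · simp [h1]
      · simp only [Prod.smul_snd, smul_eq_mul]
        field_simp
        linarith
  · rintro ⟨t, rfl⟩
    rw [cross_smul, cross_vector_self, mul_zero]

theorem nonattacking_iff {r q : ℕ} {M : Fin r → ℝ × ℝ} (hM : ∀ j, M j ≠ 0)
    (p : Fin q → ℝ × ℝ) :
    Nonattacking M p ↔ ∀ i k, i ≠ k → ∀ j, cross (M j) (p k - p i) ≠ 0 := by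
  simp only [Nonattacking, Attacks, not_exists]
  refine forall₄_congr fun i k _ j => ?_
  rw [Ne, cross_eq_zero_iff (hM j), not_exists]

/-! ### Realizing real configurations on large boards -/

theorem eventually_sign_eq {X : Type*} {l : Filter X} {f : X → ℝ} {a : ℝ}
    (h : Tendsto f l (𝓝 a)) (ha : a ≠ 0) :
    ∀ᶠ x in l, SignType.sign (f x) = SignType.sign a := by
  have := (continuousAt_sign_of_ne_zero ha).tendsto.comp h
  exact this.eventually_mem ((isOpen_discrete {SignType.sign a}).mem_nhds rfl)

theorem tendsto_floor_mul_div (x : ℝ) :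
    Tendsto (fun n : ℕ => (⌊((n : ℝ) + 1) * x⌋ : ℝ) / ((n : ℝ) + 1)) atTop (𝓝 x) := by
  have h0 : Tendsto (fun n : ℕ => 1 / ((n : ℝ) + 1)) atTop (𝓝 0) :=
    tendsto_one_div_add_atTop_nhds_zero_nat
  have h1 : Tendsto (fun n : ℕ => x - 1 / ((n : ℝ) + 1)) atTop (𝓝 x) := by
    simpa using h0.const_sub x
  refine tendsto_of_tendsto_of_tendsto_of_le_of_le h1 tendsto_const_nhds ?_ ?_
  · intro n
    have hn : (0 : ℝ) < (n : ℝ) + 1 := by positivity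
    change x - 1 / ((n : ℝ) + 1) ≤ (⌊((n : ℝ) + 1) * x⌋ : ℝ) / ((n : ℝ) + 1)
    rw [le_div_iff₀ hn, sub_mul, one_div_mul_cancel hn.ne']
    linarith [Int.lt_floor_add_one (((n : ℝ) + 1) * x)]
  · intro n
    have hn : (0 : ℝ) < (n : ℝ) + 1 := by positivity
    change (⌊((n : ℝ) + 1) * x⌋ : ℝ) / ((n : ℝ) + 1) ≤ x
    rw [div_le_iff₀ hn]
    linarith [Int.floor_le (((n : ℝ) + 1) * x)]

/-- Every point configuration without attacks has the type of one on a large dilated board. -/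
theorem labelledType_mem_labelledTypes {r q : ℕ} {M : Fin r → ℝ × ℝ} (hM : ∀ j, M j ≠ 0)
    {B : Set (ℝ × ℝ)} (hB : (interior B).Nonempty) {p : Fin q → ℝ × ℝ}
    (hp : ∀ i k, i ≠ k → ∀ j, cross (M j) (p k - p i) ≠ 0) :
    labelledType M p ∈ labelledTypes M B q := by
  obtain ⟨x, hx⟩ := hB
  -- Shrink the configuration towards an interior point `x` of the board.
  have h1 : ∀ᶠ ε : ℝ in 𝓝[>] 0, ∀ i, x + ε • p i ∈ interior B := by
    rw [eventually_all]
    intro i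
    have hc : Continuous fun ε : ℝ => x + ε • p i := by fun_prop
    have := (hc.tendsto 0).eventually (isOpen_interior.mem_nhds (by simpa using hx))
    exact this.filter_mono nhdsWithin_le_nhds
  obtain ⟨ε, hε, hε0⟩ := (h1.and self_mem_nhdsWithin).exists
  replace hε0 : 0 < ε := hε0
  -- Dilate by `n + 1` and round down; after rescaling, the rounding error tends to zero.
  let Q : ℕ → Fin q → ℝ × ℝ := fun n i =>
    ((⌊((n : ℝ) + 1) * (x + ε • p i).1⌋ : ℝ), (⌊((n : ℝ) + 1) * (x + ε • p i).2⌋ : ℝ))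
  have hQ : ∀ i, Tendsto (fun n : ℕ => ((n : ℝ) + 1)⁻¹ • Q n i) atTop (𝓝 (x + ε • p i)) := by
    intro i
    refine Prod.tendsto_iff _ _ |>.2 ⟨?_, ?_⟩
    · refine (tendsto_floor_mul_div (x + ε • p i).1).congr fun n => ?_
      simp only [Q, Prod.smul_fst, smul_eq_mul]
      rw [div_eq_inv_mul]
    · refine (tendsto_floor_mul_div (x + ε • p i).2).congr fun n => ?_
      simp only [Q, Prod.smul_snd, smul_eq_mul]
      rw [div_eq_inv_mul]
  have h2 : ∀ᶠ n : ℕ in atTop, ∀ i, ((n : ℝ) + 1)⁻¹ • Q n i ∈ interior B := by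
    rw [eventually_all]
    exact fun i => (hQ i).eventually (isOpen_interior.mem_nhds (hε i))
  have h3 : ∀ᶠ n : ℕ in atTop, ∀ i k, i ≠ k → ∀ j,
      SignType.sign (cross (M j) (Q n k - Q n i)) =
        SignType.sign (cross (M j) (p k - p i)) := by
    rw [eventually_all]; intro i
    rw [eventually_all]; intro k
    by_cases hik : i = k
    · simp [hik]
    rw [eventually_imp_distrib_left]; intro _
    rw [eventually_all]; intro j
    have hc : Continuous fun v : ℝ × ℝ => cross (M j) v := by
      unfold cross; fun_prop
    have ht := (hc.tendsto _).comp ((hQ k).sub (hQ i))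
    have e : cross (M j) (x + ε • p k - (x + ε • p i)) = ε * cross (M j) (p k - p i) := by
      rw [add_sub_add_left_eq_sub, ← smul_sub, cross_smul]
    rw [e] at ht
    filter_upwards [eventually_sign_eq ht (mul_ne_zero hε0.ne' (hp i k hik j))] with n hn
    have hn1 : (0 : ℝ) < ((n : ℝ) + 1)⁻¹ := by positivity
    simpa [← smul_sub, cross_smul, sign_mul, sign_pos hn1, sign_pos hε0] using hn
  obtain ⟨n, hn2, hn3⟩ := (h2.and h3).exists
  refine ⟨n, Q n, fun i => ⟨?_, _, _, rfl⟩, ?_, ?_⟩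
  · have hn : ((n : ℝ) + 1) ≠ 0 := by positivity
    exact (Set.mem_smul_set_iff_inv_smul_mem₀ hn _ _).2 (hn2 i)
  · rw [nonattacking_iff hM]
    intro i k hik j
    rw [← sign_ne_zero, hn3 i k hik j, sign_ne_zero]
    exact hp i k hik j
  · funext i j k
    by_cases hik : i = k
    · simp [labelledType, hik]
    · exact hn3 i k hik j

theorem mem_labelledTypes_iff {r q : ℕ} {M : Fin r → ℝ × ℝ} (hM : ∀ j, M j ≠ 0)
    {B : Set (ℝ × ℝ)} (hB : (interior B).Nonempty) (T : LabelledType r q) :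
    T ∈ labelledTypes M B q ↔ ∃ p : Fin q → ℝ × ℝ,
      (∀ i k, i ≠ k → ∀ j, cross (M j) (p k - p i) ≠ 0) ∧ labelledType M p = T := by
  constructor
  · rintro ⟨n, p, -, hp, rfl⟩
    exact ⟨p, (nonattacking_iff hM p).1 hp, rfl⟩
  · rintro ⟨p, hp, rfl⟩
    exact labelledType_mem_labelledTypes hM hB hp

/-! ### Vectors of sum zero in three sectors -/

theorem sign_eq_sign_iff {a b : ℝ} (ha : a ≠ 0) (hb : b ≠ 0) :
    SignType.sign a = SignType.sign b ↔ 0 < a * b := by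
  rcases ha.lt_or_gt with h | h <;> rcases hb.lt_or_gt with h' | h'
  · simp [h, h', mul_pos_of_neg_of_neg]
  · simp [h, h', h.le]
  · simp [h, h', h'.le]
  · simp [h, h']

/-- The sector of `w` is that of `-u`. Sectors are open, so `u` can absorb a small multiple of `d`
without leaving its own. -/
theorem exists_sum_zero_of_opposite {ι : Type*} [Finite ι] (M : ι → ℝ × ℝ) {u w d : ℝ × ℝ}
    (hu : ∀ j, cross (M j) u ≠ 0)
    (huw : ∀ j, SignType.sign (cross (M j) w) = -SignType.sign (cross (M j) u)) :
    ∃ a b c : ℝ × ℝ, a + b + c = 0 ∧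
      (∀ j, SignType.sign (cross (M j) a) = SignType.sign (cross (M j) u)) ∧
      (∀ j, SignType.sign (cross (M j) b) = SignType.sign (cross (M j) w)) ∧
      (∀ j, SignType.sign (cross (M j) c) = SignType.sign (cross (M j) d)) := by
  have h : ∀ᶠ ε : ℝ in 𝓝[>] 0, ∀ j,
      SignType.sign (cross (M j) (u - ε • d)) = SignType.sign (cross (M j) u) := by
    rw [eventually_all]
    intro j
    have hc : Continuous fun ε : ℝ => cross (M j) (u - ε • d) := by
      unfold cross; fun_prop
    have ht := (hc.tendsto 0).mono_left (nhdsWithin_le_nhds (s := Set.Ioi 0))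
    simp only [zero_smul, sub_zero] at ht
    exact eventually_sign_eq ht (hu j)
  obtain ⟨ε, hε, hε0⟩ := (h.and self_mem_nhdsWithin).exists
  refine ⟨u - ε • d, -u, ε • d, by abel, hε, fun j => ?_, fun j => ?_⟩
  · rw [cross_neg, huw, Left.sign_neg]
  · rw [cross_smul, sign_mul, sign_pos hε0, one_mul]

/-- This is Cramer's linear relation between three plane vectors, paired with `m`. -/
theorem cross_three (m u w d : ℝ × ℝ) :
    cross w d * cross m u + cross d u * cross m w + cross u w * cross m d = 0 := by
  simp only [cross]; ring

/-- Three sectors that lie in no common half-plane of a move line contain vectors of sum zero. -/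
theorem exists_sum_zero {ι : Type*} [Finite ι] (M : ι → ℝ × ℝ) {u w d : ℝ × ℝ}
    (hu : ∀ j, cross (M j) u ≠ 0) (hw : ∀ j, cross (M j) w ≠ 0) (hd : ∀ j, cross (M j) d ≠ 0)
    (h : ∀ j, ¬ (SignType.sign (cross (M j) u) = SignType.sign (cross (M j) w) ∧
      SignType.sign (cross (M j) w) = SignType.sign (cross (M j) d))) :
    ∃ a b c : ℝ × ℝ, a + b + c = 0 ∧
      (∀ j, SignType.sign (cross (M j) a) = SignType.sign (cross (M j) u)) ∧
      (∀ j, SignType.sign (cross (M j) b) = SignType.sign (cross (M j) w)) ∧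
      (∀ j, SignType.sign (cross (M j) c) = SignType.sign (cross (M j) d)) := by
  have key : ∀ x y : SignType, x ≠ 0 → y ≠ 0 → x ≠ y → y = -x := by decide
  by_cases h1 : ∀ j, SignType.sign (cross (M j) u) ≠ SignType.sign (cross (M j) w)
  · exact exists_sum_zero_of_opposite M hu fun j =>
      key _ _ (sign_ne_zero.2 (hu j)) (sign_ne_zero.2 (hw j)) (h1 j)
  by_cases h2 : ∀ j, SignType.sign (cross (M j) w) ≠ SignType.sign (cross (M j) d)
  · obtain ⟨b, c, a, e, hb, hc, ha⟩ := exists_sum_zero_of_opposite M (d := u) hw fun j =>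
      key _ _ (sign_ne_zero.2 (hw j)) (sign_ne_zero.2 (hd j)) (h2 j)
    exact ⟨a, b, c, by rw [← e]; abel, ha, hb, hc⟩
  by_cases h3 : ∀ j, SignType.sign (cross (M j) d) ≠ SignType.sign (cross (M j) u)
  · obtain ⟨c, a, b, e, hc, ha, hb⟩ := exists_sum_zero_of_opposite M (d := w) hd fun j =>
      key _ _ (sign_ne_zero.2 (hd j)) (sign_ne_zero.2 (hu j)) (h3 j)
    exact ⟨a, b, c, by rw [← e]; abel, ha, hb, hc⟩
  -- No two sectors are opposite now, so each pair agrees at some move, where the third vector lies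
  -- on the other side. It will follow that the coefficients in Cramer's relation all have the same
  -- sign.
  push Not at h1 h2 h3
  obtain ⟨j1, h1⟩ := h1
  obtain ⟨j2, h2⟩ := h2
  obtain ⟨j3, h3⟩ := h3
  have g1 : ¬ SignType.sign (cross (M j1) u) = SignType.sign (cross (M j1) d) :=
    fun e => h j1 ⟨h1, h1.symm.trans e⟩
  have g2 : ¬ SignType.sign (cross (M j2) u) = SignType.sign (cross (M j2) w) :=
    fun e => h j2 ⟨e, h2⟩
  have g3 : ¬ SignType.sign (cross (M j3) d) = SignType.sign (cross (M j3) w) :=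
    fun e => h j3 ⟨(e.symm.trans h3).symm, e.symm⟩
  rw [sign_eq_sign_iff (hu _) (hw _)] at h1 g2
  rw [sign_eq_sign_iff (hw _) (hd _)] at h2
  rw [sign_eq_sign_iff (hd _) (hu _)] at h3
  rw [sign_eq_sign_iff (hu _) (hd _)] at g1
  rw [sign_eq_sign_iff (hd _) (hw _)] at g3
  have g1 := lt_of_le_of_ne (not_lt.1 g1) (mul_ne_zero (hu _) (hd _))
  have g2 := lt_of_le_of_ne (not_lt.1 g2) (mul_ne_zero (hu _) (hw _))
  have g3 := lt_of_le_of_ne (not_lt.1 g3) (mul_ne_zero (hd _) (hw _))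
  have c1 : cross w d * cross (M j1) u ^ 2 + cross d u * (cross (M j1) u * cross (M j1) w)
      = cross u w * -(cross (M j1) u * cross (M j1) d) := by
    linear_combination cross (M j1) u * cross_three (M j1) u w d
  have c2 : cross d u * cross (M j2) w ^ 2 + cross u w * (cross (M j2) w * cross (M j2) d)
      = cross w d * -(cross (M j2) u * cross (M j2) w) := by
    linear_combination cross (M j2) w * cross_three (M j2) u w d
  have c3 : cross u w * cross (M j3) d ^ 2 + cross w d * (cross (M j3) d * cross (M j3) u)
      = cross d u * -(cross (M j3) d * cross (M j3) w) := by
    linear_combination cross (M j3) d * cross_three (M j3) u w d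
  have s1 := sq_pos_of_ne_zero (hu j1)
  have s2 := sq_pos_of_ne_zero (hw j2)
  have s3 := sq_pos_of_ne_zero (hd j3)
  -- Parallel `u` and `w` would be on equal sides for all moves or on opposite sides for all moves,
  -- but they agree at `j1` and differ at `j2`.
  have hz : cross u w ≠ 0 := by
    intro hz
    have e : cross (M j1) u * cross (M j2) w = cross (M j1) w * cross (M j2) u := by
      have : cross (M j1) u * cross (M j2) w - cross (M j1) w * cross (M j2) u
          = cross (M j1) (M j2) * cross u w := by
        simp only [cross]; ring
      rw [hz, mul_zero] at this
      linarith
    have : (cross (M j1) u * cross (M j1) w) * (cross (M j2) u * cross (M j2) w)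
        = (cross (M j1) u * cross (M j2) w) ^ 2 := by
      linear_combination (-(cross (M j1) u * cross (M j2) w)) * e
    nlinarith [mul_neg_of_pos_of_neg h1 g2, sq_nonneg (cross (M j1) u * cross (M j2) w)]
  -- Each relation writes a positive multiple of one coefficient as a positive combination of the
  -- other two.
  have signs : ∀ x y z A B C A' B' C' A'' B'' C'' : ℝ, 0 < A → 0 < B → 0 < C → 0 < A' → 0 < B' →
      0 < C' → 0 < A'' → 0 < B'' → 0 < C'' → x * A + y * B = z * C → y * A' + z * B' = x * C' →
      z * A'' + x * B'' = y * C'' → 0 < z → 0 < x ∧ 0 < y := by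
    intro x y z A B C A' B' C' A'' B'' C'' hA hB hC hA' hB' hC' hA'' hB'' hC'' e1 e2 e3 hz
    have hx : 0 < x := by
      by_contra hx
      have hy : 0 < y := by
        by_contra hy
        nlinarith [mul_pos hz hC, mul_nonneg (neg_nonneg.2 (not_lt.1 hx)) hA.le,
          mul_nonneg (neg_nonneg.2 (not_lt.1 hy)) hB.le]
      nlinarith [mul_pos hz hB', mul_nonneg (neg_nonneg.2 (not_lt.1 hx)) hC'.le, mul_pos hy hA']
    refine ⟨hx, ?_⟩
    have := add_pos (mul_pos hz hA'') (mul_pos hx hB'')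
    rw [e3] at this
    exact pos_of_mul_pos_left this hC''.le
  rcases hz.lt_or_gt with hz | hz
  · obtain ⟨hx, hy⟩ := signs (-cross w d) (-cross d u) (-cross u w) _ _ _ _ _ _ _ _ _ s1 h1
      (neg_pos.2 g1) s2 h2 (neg_pos.2 g2) s3 h3 (neg_pos.2 g3) (by linarith) (by linarith)
      (by linarith) (by linarith)
    refine ⟨(-cross w d) • u, (-cross d u) • w, (-cross u w) • d, ?_, fun j => ?_, fun j => ?_,
      fun j => ?_⟩
    · ext <;> simp [cross] <;> ring
    · rw [cross_smul, sign_mul, sign_pos hx, one_mul]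
    · rw [cross_smul, sign_mul, sign_pos hy, one_mul]
    · rw [cross_smul, sign_mul, sign_pos (neg_pos.2 hz), one_mul]
  · obtain ⟨hx, hy⟩ := signs _ _ _ _ _ _ _ _ _ _ _ _ s1 h1
      (neg_pos.2 g1) s2 h2 (neg_pos.2 g2) s3 h3 (neg_pos.2 g3) c1 c2 c3 hz
    refine ⟨(cross w d) • u, (cross d u) • w, (cross u w) • d, ?_, fun j => ?_, fun j => ?_,
      fun j => ?_⟩
    · ext <;> simp [cross] <;> ring
    · rw [cross_smul, sign_mul, sign_pos hx, one_mul]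
    · rw [cross_smul, sign_mul, sign_pos hy, one_mul]
    · rw [cross_smul, sign_mul, sign_pos hz, one_mul]

/-! ### Labelled types as balanced triples of sign vectors -/

/-- The sign vectors of the plane vectors that are parallel to no move. -/
def signVectors {r : ℕ} (M : Fin r → ℝ × ℝ) : Set (Fin r → SignType) :=
  {α | ∃ v : ℝ × ℝ, (∀ j, cross (M j) v ≠ 0) ∧ (fun j => SignType.sign (cross (M j) v)) = α}

/-- The triples of sign vectors in `S` that nowhere have three equal signs. -/
def balancedTriples {r : ℕ} (S : Set (Fin r → SignType)) :
    Set ((Fin r → SignType) × (Fin r → SignType) × (Fin r → SignType)) :=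
  {t | t.1 ∈ S ∧ t.2.1 ∈ S ∧ t.2.2 ∈ S ∧ ∀ j, ¬ (t.1 j = t.2.1 j ∧ t.2.1 j = t.2.2 j)}

/-- The rows of a labelled type that belong to the differences around the triangle. -/
def cyclicRows {r : ℕ} (T : LabelledType r 3) :
    (Fin r → SignType) × (Fin r → SignType) × (Fin r → SignType) :=
  (fun j => T 0 j 1, fun j => T 1 j 2, fun j => T 2 j 0)

theorem labelledType_antisymm {r q : ℕ} (M : Fin r → ℝ × ℝ) (p : Fin q → ℝ × ℝ) (i j k) :
    labelledType M p k j i = -labelledType M p i j k := by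
  simp only [labelledType]
  rw [← Left.sign_neg, ← cross_neg, neg_sub]

/-- Antisymmetry recovers the reversed rows and forces the diagonal to vanish. -/
theorem cyclicRows_injOn {r : ℕ} :
    Set.InjOn cyclicRows {T : LabelledType r 3 | ∀ i j k, T k j i = -T i j k} := by
  intro T hT T' hT' h
  simp only [cyclicRows, Prod.mk.injEq, funext_iff] at h
  obtain ⟨h0, h1, h2⟩ := h
  have diag : ∀ x : SignType, x = -x → x = 0 := by decide
  funext i j k
  fin_cases i <;> fin_cases k <;> simp only [Fin.zero_eta, Fin.mk_one, Fin.reduceFinMk]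
  · rw [diag _ (hT 0 j 0), diag _ (hT' 0 j 0)]
  · exact h0 j
  · rw [hT 2 j 0, hT' 2 j 0, h2]
  · rw [hT 0 j 1, hT' 0 j 1, h0]
  · rw [diag _ (hT 1 j 1), diag _ (hT' 1 j 1)]
  · exact h1 j
  · exact h2 j
  · rw [hT 1 j 2, hT' 1 j 2, h1]
  · rw [diag _ (hT 2 j 2), diag _ (hT' 2 j 2)]

/-- The differences around a triangle sum to zero, which excludes three equal signs; conversely,
vectors from `exists_sum_zero` are the sides of a triangle `0, a, a + b`. -/
theorem mem_labelledTypes_three_iff {r : ℕ} {M : Fin r → ℝ × ℝ} (hM : ∀ j, M j ≠ 0)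
    {B : Set (ℝ × ℝ)} (hB : (interior B).Nonempty) (T : LabelledType r 3) :
    T ∈ labelledTypes M B 3 ↔ (∀ i j k, T k j i = -T i j k) ∧
      cyclicRows T ∈ balancedTriples (signVectors M) := by
  rw [mem_labelledTypes_iff hM hB]
  constructor
  · rintro ⟨p, hp, rfl⟩
    refine ⟨fun i j k => labelledType_antisymm M p i j k, ⟨_, hp 0 1 (by decide), rfl⟩,
      ⟨_, hp 1 2 (by decide), rfl⟩, ⟨_, hp 2 0 (by decide), rfl⟩, ?_⟩
    rintro j ⟨h1, h2⟩
    simp only [cyclicRows, labelledType] at h1 h2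
    have e : cross (M j) (p 1 - p 0) + cross (M j) (p 2 - p 1) + cross (M j) (p 0 - p 2) = 0 := by
      simp only [cross_sub]; ring
    have n0 := hp 0 1 (by decide) j
    have n1 := hp 1 2 (by decide) j
    have n2 := hp 2 0 (by decide) j
    rw [sign_eq_sign_iff n0 n1] at h1
    rw [sign_eq_sign_iff n1 n2] at h2
    generalize cross (M j) (p 1 - p 0) = x at *
    generalize cross (M j) (p 2 - p 1) = y at *
    generalize cross (M j) (p 0 - p 2) = z at *
    have : (x + y + z) * y = 0 := by rw [e, zero_mul]
    nlinarith [sq_nonneg y]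
  · rintro ⟨hT, ⟨u, hu, hu'⟩, ⟨w, hw, hw'⟩, ⟨d, hd, hd'⟩, hn⟩
    simp only [funext_iff] at hu' hw' hd'
    obtain ⟨a, b, c, e, ha, hb, hc⟩ := exists_sum_zero M hu hw hd fun j hj => hn j
      ⟨by rw [← hu', ← hw', hj.1], by rw [← hd', ← hw', hj.2]⟩
    let p : Fin 3 → ℝ × ℝ := ![0, a, a + b]
    have e1 : p 1 - p 0 = a := by simp [p]
    have e2 : p 2 - p 1 = b := by simp [p]
    have e3 : p 0 - p 2 = c := by
      simp only [p, Matrix.cons_val]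
      rw [zero_sub, neg_eq_iff_add_eq_zero, e]
    have hpT : labelledType M p = T := by
      refine cyclicRows_injOn (fun i j k => labelledType_antisymm M p i j k) hT ?_
      refine Prod.ext (funext fun j => ?_) (Prod.ext (funext fun j => ?_) (funext fun j => ?_))
      · rw [← hu', ← ha, ← e1]; rfl
      · rw [← hw', ← hb, ← e2]; rfl
      · rw [← hd', ← hc, ← e3]; rfl
    refine ⟨p, ?_, hpT⟩
    have h1 : ∀ j, T 0 j 1 ≠ 0 := fun j => by
      have := hu' j; simp only [cyclicRows] at this; rw [← this]; exact sign_ne_zero.2 (hu j)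
    have h2 : ∀ j, T 1 j 2 ≠ 0 := fun j => by
      have := hw' j; simp only [cyclicRows] at this; rw [← this]; exact sign_ne_zero.2 (hw j)
    have h3 : ∀ j, T 2 j 0 ≠ 0 := fun j => by
      have := hd' j; simp only [cyclicRows] at this; rw [← this]; exact sign_ne_zero.2 (hd j)
    have key : ∀ x : SignType, x ≠ 0 → -x ≠ 0 := by decide
    intro i k hik j
    rw [← sign_ne_zero]
    change labelledType M p i j k ≠ 0
    rw [hpT]
    fin_cases i <;> fin_cases k <;> simp only [Fin.zero_eta, Fin.mk_one, Fin.reduceFinMk]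
    · exact absurd rfl hik
    · exact h1 j
    · rw [hT 2 j 0]; exact key _ (h3 j)
    · rw [hT 0 j 1]; exact key _ (h1 j)
    · exact absurd rfl hik
    · exact h2 j
    · exact h3 j
    · rw [hT 1 j 2]; exact key _ (h2 j)
    · exact absurd rfl hik

/-! ### The sectors of a sorted move set -/

/-- The signs, with respect to `r` sorted moves, of the vectors in the `n`-th of the `2 * r`
sectors, listed counterclockwise from the first move. -/
def sectorSign (r n : ℕ) : Fin r → SignType :=
  fun j => if (j : ℕ) ≤ n ∧ n < j + r then 1 else -1

theorem cross_nonneg_of_le {r : ℕ} {M : Fin r → ℝ × ℝ} (hS : IsSorted M) {i j : Fin r}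
    (h : i ≤ j) : 0 ≤ cross (M i) (M j) := by
  rcases h.eq_or_lt with rfl | h
  · exact (cross_vector_self _).ge
  · exact (hS _ _ h).le

/-- By sortedness, a move listed between the first one and `M j` is a nonnegative combination of
these two. So if `v` is left of both, it is left of everything between them. -/
theorem exists_threshold {r : ℕ} {M : Fin r → ℝ × ℝ} (hS : IsSorted M) (hr : 0 < r)
    {v : ℝ × ℝ} (hv : ∀ j, cross (M j) v ≠ 0) (h0 : 0 < cross (M ⟨0, hr⟩) v) :
    ∃ n < r, ∀ j : Fin r, 0 < cross (M j) v ↔ (j : ℕ) ≤ n := by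
  have down : ∀ i j : Fin r, i ≤ j → 0 < cross (M j) v → 0 < cross (M i) v := by
    intro i j hij hj
    refine lt_of_le_of_ne ?_ (hv i).symm
    rcases hij.eq_or_lt with rfl | hij
    · exact hj.le
    have e : cross (M ⟨0, hr⟩) (M j) * cross (M i) v = cross (M i) (M j) * cross (M ⟨0, hr⟩) v +
        cross (M ⟨0, hr⟩) (M i) * cross (M j) v := by
      simp only [cross]; ring
    have h0j : 0 < cross (M ⟨0, hr⟩) (M j) :=
      hS _ _ (lt_of_le_of_lt (Fin.mk_le_of_le_val (Nat.zero_le _)) hij)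
    have h0i : 0 ≤ cross (M ⟨0, hr⟩) (M i) :=
      cross_nonneg_of_le hS (Fin.mk_le_of_le_val (Nat.zero_le _))
    refine nonneg_of_mul_nonneg_right (?_ : 0 ≤ cross (M ⟨0, hr⟩) (M j) * _) h0j
    rw [e]
    exact add_nonneg (mul_nonneg (hS _ _ hij).le h0.le) (mul_nonneg h0i hj.le)
  let P : Finset (Fin r) := Finset.univ.filter fun j => 0 < cross (M j) v
  have hP : P.Nonempty := ⟨⟨0, hr⟩, by simpa [P] using h0⟩
  refine ⟨P.max' hP, (P.max' hP).2, fun j => ⟨fun hj => ?_, fun hj => ?_⟩⟩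
  · exact Fin.le_def.1 (P.le_max' j (by simpa [P] using hj))
  · refine down j _ (Fin.le_def.2 hj) ?_
    have := P.max'_mem hP
    simpa [P] using this

theorem sectorSign_of_lt {r n : ℕ} (hn : n < r) (j : Fin r) :
    sectorSign r n j = if (j : ℕ) ≤ n then 1 else -1 := by
  unfold sectorSign
  congr 1
  apply propext
  omega

theorem sectorSign_add {r n : ℕ} (hn : n < r) (j : Fin r) :
    sectorSign r (n + r) j = -sectorSign r n j := by
  have := j.2
  rw [sectorSign_of_lt hn]
  unfold sectorSign
  by_cases h : (j : ℕ) ≤ n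
  · rw [if_pos h, if_neg (by omega)]
  · rw [if_neg h, if_pos (by omega), neg_neg]

/-- The sum of the two bounding rays serves as witness. The last sector is bounded by the last move
and `-M 0`; for `r = 1` these are opposite, and a quarter turn of `M 0` is used instead. -/
theorem exists_mem_sector {r : ℕ} {M : Fin r → ℝ × ℝ} (hM : ∀ j, M j ≠ 0) (hS : IsSorted M)
    {n : ℕ} (hn : n < r) : ∃ v : ℝ × ℝ, ∀ j : Fin r,
      ((j : ℕ) ≤ n → 0 < cross (M j) v) ∧ (n < (j : ℕ) → cross (M j) v < 0) := by
  by_cases h1 : n + 1 < r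
  · refine ⟨M ⟨n, hn⟩ + M ⟨n + 1, h1⟩, fun j => ⟨fun hj => ?_, fun hj => ?_⟩⟩
    · rw [cross_add]
      exact add_pos_of_nonneg_of_pos (cross_nonneg_of_le hS (Fin.le_def.2 hj))
        (hS _ _ (Fin.lt_def.2 (Nat.lt_succ_of_le hj)))
    · rw [cross_add, cross_swap _ (M j), cross_swap _ (M j)]
      linarith [hS ⟨n, hn⟩ j (Fin.lt_def.2 hj),
        cross_nonneg_of_le hS (i := ⟨n + 1, h1⟩) (j := j) (Fin.le_def.2 hj)]
  obtain rfl : r = n + 1 := by omega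
  rcases Nat.eq_zero_or_pos n with rfl | hn0
  · refine ⟨(-(M 0).2, (M 0).1), fun j => ⟨fun _ => ?_, fun hj => by omega⟩⟩
    obtain rfl : j = 0 := Fin.ext (by have := j.2; simp only [Fin.val_zero]; omega)
    have : 0 < (M 0).1 * (M 0).1 + (M 0).2 * (M 0).2 := by
      by_contra hle
      have h1 : (M 0).1 = 0 := by nlinarith [sq_nonneg (M 0).1, sq_nonneg (M 0).2]
      have h2 : (M 0).2 = 0 := by nlinarith [sq_nonneg (M 0).1, sq_nonneg (M 0).2]
      exact hM 0 (Prod.ext h1 h2)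
    simp only [cross]
    linarith
  · refine ⟨M (Fin.last n) - M 0, fun j => ⟨fun _ => ?_, fun hj => by omega⟩⟩
    rw [cross_sub, cross_swap (M 0)]
    rcases (Fin.zero_le j).eq_or_lt with rfl | hj
    · rw [cross_vector_self]
      have := hS 0 (Fin.last n) (Fin.lt_def.2 hn0)
      linarith
    · linarith [hS 0 j hj, cross_nonneg_of_le hS (Fin.le_last j)]

/-- Negating a vector exchanges the sectors `n` and `n + r`, so only vectors left of the first move
need direct treatment. -/
theorem signVectors_eq_of_isSorted {r : ℕ} (hr : 0 < r) {M : Fin r → ℝ × ℝ}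
    (hM : ∀ j, M j ≠ 0) (hS : IsSorted M) :
    signVectors M = sectorSign r '' {n | n < 2 * r} := by
  have of_lt : ∀ (v : ℝ × ℝ) (n : ℕ), n < r → (∀ j, cross (M j) v ≠ 0) →
      (∀ j : Fin r, 0 < cross (M j) v ↔ (j : ℕ) ≤ n) →
      ∀ j, SignType.sign (cross (M j) v) = sectorSign r n j := by
    intro v n hn hv h j
    rw [sectorSign_of_lt hn]
    by_cases hj : (j : ℕ) ≤ n
    · rw [if_pos hj, sign_pos ((h j).2 hj)]
    · rw [if_neg hj, sign_neg (lt_of_le_of_ne (not_lt.1 fun h' => hj ((h j).1 h')) (hv j))]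
  ext α
  constructor
  · rintro ⟨v, hv, rfl⟩
    rcases (hv ⟨0, hr⟩).lt_or_gt with h0 | h0
    · have hv' : ∀ j, cross (M j) (-v) ≠ 0 := fun j => by
        rw [cross_neg]; exact neg_ne_zero.2 (hv j)
      obtain ⟨n, hn, h⟩ := exists_threshold hS hr hv' (by rw [cross_neg]; exact neg_pos.2 h0)
      refine ⟨n + r, by simp only [Set.mem_ofPred_eq]; omega, funext fun j => ?_⟩
      rw [sectorSign_add hn, ← of_lt _ n hn hv' h, cross_neg, Left.sign_neg, neg_neg]
    · obtain ⟨n, hn, h⟩ := exists_threshold hS hr hv h0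
      exact ⟨n, by simp only [Set.mem_ofPred_eq]; omega,
        funext fun j => (of_lt v n hn hv h j).symm⟩
  · rintro ⟨n, hn, rfl⟩
    simp only [Set.mem_ofPred_eq] at hn
    have main : ∀ n < r, ∃ v : ℝ × ℝ, (∀ j, cross (M j) v ≠ 0) ∧
        ∀ j, SignType.sign (cross (M j) v) = sectorSign r n j := by
      intro n hn
      obtain ⟨v, hv⟩ := exists_mem_sector hM hS hn
      have hv0 : ∀ j, cross (M j) v ≠ 0 := fun j => by
        rcases le_or_gt (j : ℕ) n with h | h
        · exact ((hv j).1 h).ne'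
        · exact ((hv j).2 h).ne
      refine ⟨v, hv0, of_lt v n hn hv0 fun j => ⟨fun h => ?_, (hv j).1⟩⟩
      by_contra h'
      exact lt_asymm h ((hv j).2 (not_le.1 h'))
    by_cases h : n < r
    · obtain ⟨v, hv, hv'⟩ := main n h
      exact ⟨v, hv, funext hv'⟩
    · obtain ⟨v, hv, hv'⟩ := main (n - r) (by omega)
      refine ⟨-v, fun j => ?_, funext fun j => ?_⟩
      · rw [cross_neg]; exact neg_ne_zero.2 (hv j)
      · rw [cross_neg, Left.sign_neg, hv', ← sectorSign_add (by omega),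
          Nat.sub_add_cancel (not_lt.1 h)]

/-! ### Counting balanced triples of sectors -/

theorem sectorSign_eq_iff {r n m : ℕ} (j : Fin r) :
    sectorSign r n j = sectorSign r m j ↔
      (((j : ℕ) ≤ n ∧ n < j + r) ↔ ((j : ℕ) ≤ m ∧ m < j + r)) := by
  have h : (1 : SignType) ≠ -1 := by decide
  unfold sectorSign
  by_cases h1 : (j : ℕ) ≤ n ∧ n < j + r <;> by_cases h2 : (j : ℕ) ≤ m ∧ m < j + r <;>
    simp only [h1, h2, if_true, if_false, h, h.symm, and_self, not_true, iff_true, iff_false]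

theorem sectorSign_injOn (r : ℕ) : Set.InjOn (sectorSign r) {n | n < 2 * r} := by
  have aux : ∀ n m, n < m → m < 2 * r → sectorSign r n ≠ sectorSign r m := by
    intro n m hnm hm h
    have H : ∀ j : ℕ, j < r → ((j ≤ n ∧ n < j + r) ↔ (j ≤ m ∧ m < j + r)) := fun j hj =>
      (sectorSign_eq_iff ⟨j, hj⟩).1 (congrFun h ⟨j, hj⟩)
    -- The separating move is `m`, `m - r` or `n`, according to the case.
    by_cases h1 : m < r
    · have := H m h1; omega
    · by_cases h2 : m - r ≤ n
      · have := H (m - r) (by omega); omega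
      · have := H n (by omega); omega
  intro n hn m hm h
  rcases lt_trichotomy n m with h' | h' | h'
  · exact absurd h (aux n m h' hm)
  · exact h'
  · exact absurd h.symm (aux m n h' hn)

/-- The triples of sectors that lie in no common half-plane of a move line. -/
def balancedSectors (r : ℕ) : Finset (ℕ × ℕ × ℕ) :=
  (Finset.range (2 * r) ×ˢ Finset.range (2 * r) ×ˢ Finset.range (2 * r)).filter fun t =>
    ∀ j : Fin r, ¬ (sectorSign r t.1 j = sectorSign r t.2.1 j ∧
      sectorSign r t.2.1 j = sectorSign r t.2.2 j)

/-- Three sectors lie in a common half-plane of a move line exactly when they lie among the `r`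
consecutive sectors that start with some sector. -/
theorem exists_common_side_iff {r a b c : ℕ} (ha : a < 2 * r) (hb : b < 2 * r) (hc : c < 2 * r) :
    (∃ j : Fin r, sectorSign r a j = sectorSign r b j ∧ sectorSign r b j = sectorSign r c j) ↔
      ∃ s < 2 * r, ∃ x < r, ∃ y < r, ∃ z < r, (x = 0 ∨ y = 0 ∨ z = 0) ∧
        (a = s + x ∨ a + 2 * r = s + x) ∧ (b = s + y ∨ b + 2 * r = s + y) ∧
        (c = s + z ∨ c + 2 * r = s + z) := by
  constructor
  · rintro ⟨⟨j, hj⟩, h1, h2⟩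
    rw [sectorSign_eq_iff] at h1 h2
    simp only at h1 h2
    -- The number of counterclockwise steps from `s` to `n` modulo `2 * r`.
    let f : ℕ → ℕ → ℕ := fun s n => if s ≤ n then n - s else n + 2 * r - s
    have hf : ∀ s n, s < 2 * r → f s n < r → n = s + f s n ∨ n + 2 * r = s + f s n := by
      intro s n hs h
      simp only [f] at h ⊢
      split_ifs at h ⊢ <;> omega
    have f0 : ∀ s, f s s = 0 := fun s => by simp [f]
    -- One side of a move line is a cyclic run of `r` sectors, so one of the three sectors comes
    -- first.
    have key : (f a b < r ∧ f a c < r) ∨ (f b a < r ∧ f b c < r) ∨ (f c a < r ∧ f c b < r) := by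
      simp only [f]
      by_cases hab : a ≤ b <;> by_cases hbc : b ≤ c <;> by_cases hac : a ≤ c <;>
        split_ifs <;> omega
    have hr : 0 < r := by omega
    rcases key with ⟨k1, k2⟩ | ⟨k1, k2⟩ | ⟨k1, k2⟩
    · exact ⟨a, ha, 0, hr, _, k1, _, k2, Or.inl rfl, Or.inl rfl, hf _ _ ha k1, hf _ _ ha k2⟩
    · exact ⟨b, hb, _, k1, 0, hr, _, k2, Or.inr (Or.inl rfl), hf _ _ hb k1, Or.inl rfl,
        hf _ _ hb k2⟩
    · exact ⟨c, hc, _, k1, _, k2, 0, hr, Or.inr (Or.inr rfl), hf _ _ hc k1, hf _ _ hc k2,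
        Or.inl rfl⟩
  · rintro ⟨s, hs, x, hx, y, hy, z, hz, -, h1, h2, h3⟩
    -- The run starting at `s` is the left side of move `s`, or the right side of move `s - r`.
    by_cases h : s < r
    · refine ⟨⟨s, h⟩, ?_⟩
      simp only [sectorSign_eq_iff]
      omega
    · refine ⟨⟨s - r, by omega⟩, ?_⟩
      simp only [sectorSign_eq_iff]
      omega

/-- A bad triple is encoded by its first sector and three offsets below `r`, at least one of them
zero, hence `cube \ cube'`. The first sector is unique: two different ones would each follow the
other in fewer than `r` steps, but a full turn has `2 * r`. -/
theorem card_unbalancedSectors (r : ℕ) :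
    ((Finset.range (2 * r) ×ˢ Finset.range (2 * r) ×ˢ Finset.range (2 * r)).filter fun t =>
      ¬ ∀ j : Fin r, ¬ (sectorSign r t.1 j = sectorSign r t.2.1 j ∧
        sectorSign r t.2.1 j = sectorSign r t.2.2 j)).card = 2 * r * (r ^ 3 - (r - 1) ^ 3) := by
  let wrap : ℕ → ℕ := fun n => if n < 2 * r then n else n - 2 * r
  let cube := Finset.range r ×ˢ Finset.range r ×ˢ Finset.range r
  let cube' := Finset.Ico 1 r ×ˢ Finset.Ico 1 r ×ˢ Finset.Ico 1 r
  have hc : (Finset.range (2 * r) ×ˢ (cube \ cube')).card = 2 * r * (r ^ 3 - (r - 1) ^ 3) := by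
    rw [Finset.card_product, Finset.card_range, Finset.card_sdiff_of_subset]
    · simp only [cube, cube', Finset.card_product, Finset.card_range, Nat.card_Ico]
      ring_nf
    · intro t
      simp only [cube, cube', Finset.mem_product, Finset.mem_range, Finset.mem_Ico]
      omega
  rw [← hc]
  symm
  refine Finset.card_bij
    (fun p _ => (wrap (p.1 + p.2.1), wrap (p.1 + p.2.2.1), wrap (p.1 + p.2.2.2))) ?_ ?_ ?_
  · rintro ⟨s, x, y, z⟩ h
    simp only [cube, cube', Finset.mem_product, Finset.mem_sdiff, Finset.mem_range,
      Finset.mem_Ico] at h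
    have hw : ∀ n, n < 4 * r → wrap n < 2 * r ∧ (wrap n = n ∨ wrap n + 2 * r = n) := by
      intro n hn
      simp only [wrap]
      split_ifs <;> omega
    have w1 := hw (s + x) (by omega)
    have w2 := hw (s + y) (by omega)
    have w3 := hw (s + z) (by omega)
    simp only [Finset.mem_filter, Finset.mem_product, Finset.mem_range, not_forall, not_not]
    refine ⟨⟨w1.1, w2.1, w3.1⟩, ?_⟩
    rw [exists_common_side_iff w1.1 w2.1 w3.1]
    exact ⟨s, h.1, x, h.2.1.1, y, h.2.1.2.1, z, h.2.1.2.2, by omega, w1.2, w2.2, w3.2⟩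
  · rintro ⟨s, x, y, z⟩ h ⟨s', x', y', z'⟩ h' e
    simp only [cube, cube', Finset.mem_product, Finset.mem_sdiff, Finset.mem_range,
      Finset.mem_Ico] at h h'
    have hw : ∀ n m, n < 4 * r → m < 4 * r → wrap n = wrap m →
        n = m ∨ n + 2 * r = m ∨ m + 2 * r = n := by
      intro n m hn hm
      simp only [wrap]
      split_ifs <;> omega
    simp only [Prod.mk.injEq] at e ⊢
    have w1 := hw _ _ (by omega) (by omega) e.1
    have w2 := hw _ _ (by omega) (by omega) e.2.1
    have w3 := hw _ _ (by omega) (by omega) e.2.2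
    have hs : s = s' := by omega
    omega
  · rintro ⟨a, b, c⟩ h
    simp only [Finset.mem_filter, Finset.mem_product, Finset.mem_range, not_forall,
      not_not] at h
    obtain ⟨⟨ha, hb, hc'⟩, h⟩ := h
    rw [exists_common_side_iff ha hb hc'] at h
    obtain ⟨s, hs, x, hx, y, hy, z, hz, h0, h1, h2, h3⟩ := h
    have hw : ∀ n m, n < 2 * r → (n = m ∨ n + 2 * r = m) → wrap m = n := by
      intro n m hn hm
      simp only [wrap]
      split_ifs <;> omega
    refine ⟨⟨s, x, y, z⟩, ?_, ?_⟩
    · simp only [cube, cube', Finset.mem_product, Finset.mem_sdiff, Finset.mem_range,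
        Finset.mem_Ico]
      omega
    · simp only [hw _ _ ha h1, hw _ _ hb h2, hw _ _ hc' h3]

theorem card_balancedSectors (r : ℕ) (hr : 1 ≤ r) :
    (balancedSectors r).card = 2 * r * (r ^ 2 + 3 * r - 1) := by
  have h := Finset.card_filter_add_card_filter_not
    (s := Finset.range (2 * r) ×ˢ Finset.range (2 * r) ×ˢ Finset.range (2 * r))
    (fun t => ∀ j : Fin r, ¬ (sectorSign r t.1 j = sectorSign r t.2.1 j ∧
      sectorSign r t.2.1 j = sectorSign r t.2.2 j))
  rw [card_unbalancedSectors] at h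
  simp only [Finset.card_product, Finset.card_range] at h
  change (balancedSectors r).card + _ = _ at h
  obtain ⟨k, rfl⟩ : ∃ k, r = k + 1 := ⟨r - 1, by omega⟩
  have e1 : (k + 1) ^ 3 - (k + 1 - 1) ^ 3 = 3 * k ^ 2 + 3 * k + 1 := by
    rw [Nat.add_sub_cancel]
    apply Nat.sub_eq_of_eq_add
    ring
  have e2 : (k + 1) ^ 2 + 3 * (k + 1) - 1 = k ^ 2 + 5 * k + 3 := by
    apply Nat.sub_eq_of_eq_add
    ring
  rw [e1] at h
  rw [e2]
  linarith

theorem ncard_balancedTriples {r : ℕ} (hr : 1 ≤ r) :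
    (balancedTriples (sectorSign r '' {n | n < 2 * r})).ncard =
      2 * r * (r ^ 2 + 3 * r - 1) := by
  rw [← card_balancedSectors r hr, ← Set.ncard_coe_finset]
  have : balancedTriples (sectorSign r '' {n | n < 2 * r}) =
      (fun t : ℕ × ℕ × ℕ => (sectorSign r t.1, sectorSign r t.2.1, sectorSign r t.2.2)) ''
        (balancedSectors r : Set (ℕ × ℕ × ℕ)) := by
    ext ⟨α, β, γ⟩
    constructor
    · rintro ⟨⟨a, ha, rfl⟩, ⟨b, hb, rfl⟩, ⟨c, hc, rfl⟩, h⟩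
      exact ⟨(a, b, c), by simpa [balancedSectors] using ⟨⟨ha, hb, hc⟩, by simpa using h⟩, rfl⟩
    · rintro ⟨⟨a, b, c⟩, ht, e⟩
      simp only [Prod.mk.injEq] at e
      obtain ⟨rfl, rfl, rfl⟩ := e
      simp only [balancedSectors, Finset.coe_filter, Finset.mem_product, Finset.mem_range,
        Set.mem_ofPred_eq] at ht
      exact ⟨⟨a, ht.1.1, rfl⟩, ⟨b, ht.1.2.1, rfl⟩, ⟨c, ht.1.2.2, rfl⟩, ht.2⟩
  rw [this]
  refine Set.InjOn.ncard_image ?_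
  rintro ⟨a, b, c⟩ ht ⟨a', b', c'⟩ ht' e
  simp only [balancedSectors, Finset.coe_filter, Finset.mem_product, Finset.mem_range,
    Set.mem_ofPred_eq] at ht ht'
  simp only [Prod.mk.injEq] at e ⊢
  exact ⟨sectorSign_injOn r ht.1.1 ht'.1.1 e.1, sectorSign_injOn r ht.1.2.1 ht'.1.2.1 e.2.1,
    sectorSign_injOn r ht.1.2.2 ht'.1.2.2 e.2.2⟩

/-! ### Reorienting and sorting the moves -/

theorem IsMoveSet.cross_ne_zero {r : ℕ} {M : Fin r → ℝ × ℝ} (hM : IsMoveSet M) {i j : Fin r}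
    (h : i ≠ j) : cross (M i) (M j) ≠ 0 := fun h0 => by
  obtain ⟨t, ht⟩ := (cross_eq_zero_iff (hM.1 i) _).1 h0
  exact hM.2 i j h t ht

theorem cross_reorient {r : ℕ} (e : Equiv.Perm (Fin r)) (ε : Fin r → ℤˣ) (M : Fin r → ℝ × ℝ)
    (j : Fin r) (v : ℝ × ℝ) :
    cross (reorient e ε M j) v = ((ε j : ℤ) : ℝ) * cross (M (e j)) v :=
  cross_smul_left _ _ _

theorem unit_cast_ne_zero (u : ℤˣ) : ((u : ℤ) : ℝ) ≠ 0 :=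
  Int.cast_ne_zero.2 u.ne_zero

theorem reorient_ne_zero {r : ℕ} (e : Equiv.Perm (Fin r)) (ε : Fin r → ℤˣ) {M : Fin r → ℝ × ℝ}
    (hM : ∀ j, M j ≠ 0) (j : Fin r) : reorient e ε M j ≠ 0 :=
  smul_ne_zero (unit_cast_ne_zero _) (hM _)

theorem reorient_reorient {r : ℕ} (e e' : Equiv.Perm (Fin r)) (ε ε' : Fin r → ℤˣ)
    (M : Fin r → ℝ × ℝ) :
    reorient e ε (reorient e' ε' M) = reorient (e.trans e') (fun j => ε j * ε' (e j)) M := by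
  funext j
  simp [reorient, smul_smul]

theorem reorient_symm {r : ℕ} (e : Equiv.Perm (Fin r)) (ε : Fin r → ℤˣ) (M : Fin r → ℝ × ℝ) :
    reorient e.symm (fun j => ε (e.symm j)) (reorient e ε M) = M := by
  rw [reorient_reorient]
  funext j
  simp [reorient]

theorem labelledType_reorient {r q : ℕ} (e : Equiv.Perm (Fin r)) (ε : Fin r → ℤˣ)
    (M : Fin r → ℝ × ℝ) (p : Fin q → ℝ × ℝ) :
    labelledType (reorient e ε M) p = fun i j k =>
      SignType.sign ((ε j : ℤ) : ℝ) * labelledType M p i (e j) k := by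
  funext i j k
  simp only [labelledType, cross_reorient, sign_mul]

theorem attacks_reorient {r : ℕ} (e : Equiv.Perm (Fin r)) (ε : Fin r → ℤˣ)
    (M : Fin r → ℝ × ℝ) (x y : ℝ × ℝ) : Attacks (reorient e ε M) x y ↔ Attacks M x y := by
  constructor
  · rintro ⟨j, t, h⟩
    exact ⟨e j, t * ((ε j : ℤ) : ℝ), by rw [h, reorient, smul_smul]⟩
  · rintro ⟨j, t, h⟩
    refine ⟨e.symm j, t * (((ε (e.symm j) : ℤ) : ℝ))⁻¹, ?_⟩
    rw [h, reorient, smul_smul, inv_mul_cancel_right₀ (unit_cast_ne_zero _),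
      Equiv.apply_symm_apply]

/-- Attacks depend only on the move lines, so reorientation just permutes the moves and flips signs
in each type. -/
theorem labelledTypes_reorient {r q : ℕ} (e : Equiv.Perm (Fin r)) (ε : Fin r → ℤˣ)
    (M : Fin r → ℝ × ℝ) (B : Set (ℝ × ℝ)) :
    labelledTypes (reorient e ε M) B q =
      (fun T i j k => SignType.sign ((ε j : ℤ) : ℝ) * T i (e j) k) '' labelledTypes M B q := by
  have hN : ∀ p : Fin q → ℝ × ℝ, Nonattacking (reorient e ε M) p ↔ Nonattacking M p := fun p => by
    simp only [Nonattacking, attacks_reorient]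
  ext T
  constructor
  · rintro ⟨n, p, hp, hn, rfl⟩
    exact ⟨_, ⟨n, p, hp, (hN p).1 hn, rfl⟩, (labelledType_reorient e ε M p).symm⟩
  · rintro ⟨_, ⟨n, p, hp, hn, rfl⟩, rfl⟩
    exact ⟨n, p, hp, (hN p).2 hn, labelledType_reorient e ε M p⟩

/-- Every move set can be reoriented so that it is sorted. -/
theorem exists_isSorted_reorient {r : ℕ} {M : Fin r → ℝ × ℝ} (hM : IsMoveSet M) :
    ∃ (e : Equiv.Perm (Fin r)) (ε : Fin r → ℤˣ), IsSorted (reorient e ε M) := by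
  -- Turn every move to have angle in `[0, π)`.
  have flip : ∀ j, ∃ u : ℤˣ, 0 < (((u : ℤ) : ℝ) • M j).2 ∨
      (((u : ℤ) : ℝ) • M j).2 = 0 ∧ 0 < (((u : ℤ) : ℝ) • M j).1 := by
    intro j
    rcases lt_trichotomy (M j).2 0 with h | h | h
    · exact ⟨-1, by simp [h]⟩
    · rcases lt_trichotomy (M j).1 0 with h' | h' | h'
      · exact ⟨-1, by simp [h, h']⟩
      · exact absurd (Prod.ext h' h) (hM.1 j)
      · exact ⟨1, by simp [h, h']⟩
    · exact ⟨1, by simp [h]⟩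
  choose u hu using flip
  let N : Fin r → ℝ × ℝ := fun j => ((u j : ℤ) : ℝ) • M j
  -- Minus the cotangent of the angle, which increases on `(0, π)`; `⊥` stands for angle zero.
  let key : Fin r → WithBot ℝ := fun j => if (N j).2 = 0 then ⊥ else ((-((N j).1 / (N j).2) : ℝ))
  have hN : ∀ j, 0 < (N j).2 ∨ (N j).2 = 0 ∧ 0 < (N j).1 := hu
  have hNc : ∀ i j, i ≠ j → cross (N i) (N j) ≠ 0 := fun i j h => by
    simp only [N, cross_smul, cross_smul_left]
    exact mul_ne_zero (unit_cast_ne_zero _)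
      (mul_ne_zero (unit_cast_ne_zero _) (hM.cross_ne_zero h))
  have hkey : ∀ i j, key i ≤ key j → 0 ≤ cross (N i) (N j) := by
    intro i j h
    simp only [key] at h
    simp only [cross]
    rcases hN i with hi | ⟨hi, hi'⟩ <;> rcases hN j with hj | ⟨hj, hj'⟩
    · rw [if_neg hi.ne', if_neg hj.ne', WithBot.coe_le_coe, neg_le_neg_iff,
        div_le_div_iff₀ hj hi] at h
      linarith
    · rw [if_neg hi.ne', if_pos hj] at h
      simp at h
    · rw [hi, zero_mul, sub_zero]
      positivity
    · simp [hi, hj]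
  let e := Tuple.sort key
  refine ⟨e, fun j => u (e j), fun i j hij => ?_⟩
  have hm : key (e i) ≤ key (e j) := Tuple.monotone_sort key hij.le
  exact lt_of_le_of_ne (hkey _ _ hm) (hNc _ _ (e.injective.ne hij.ne)).symm

/-! ### Labelled counts and the free action of relabelling -/

theorem ncard_labelledTypes_of_isSorted {r : ℕ} (hr : 1 ≤ r) {M : Fin r → ℝ × ℝ}
    {B : Set (ℝ × ℝ)} (hM : ∀ j, M j ≠ 0) (hS : IsSorted M) (hB : (interior B).Nonempty) :
    (labelledTypes M B 3).ncard = 2 * r * (r ^ 2 + 3 * r - 1) := by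
  rw [← ncard_balancedTriples hr, ← signVectors_eq_of_isSorted hr hM hS]
  refine Set.ncard_congr (fun T _ => cyclicRows T) ?_ ?_ ?_
  · exact fun T hT => ((mem_labelledTypes_three_iff hM hB T).1 hT).2
  · exact fun T T' hT hT' h => cyclicRows_injOn
      ((mem_labelledTypes_three_iff hM hB T).1 hT).1
      ((mem_labelledTypes_three_iff hM hB T').1 hT').1 h
  · rintro ⟨α, β, γ⟩ h
    have diag : ∀ x : SignType, - -x = x := by decide
    let T : LabelledType r 3 := fun i j k =>
      ![![0, α j, -γ j], ![-α j, 0, β j], ![γ j, -β j, 0]] i k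
    have hT : cyclicRows T = (α, β, γ) := rfl
    refine ⟨T, (mem_labelledTypes_three_iff hM hB T).2 ⟨fun i j k => ?_, hT ▸ h⟩, hT⟩
    fin_cases i <;> fin_cases k <;> simp [T]

theorem ncard_labelledTypes {r : ℕ} (hr : 1 ≤ r) {M : Fin r → ℝ × ℝ}
    {B : Set (ℝ × ℝ)} (hM : IsMoveSet M) (hB : (interior B).Nonempty) :
    (labelledTypes M B 3).ncard = 2 * r * (r ^ 2 + 3 * r - 1) := by
  obtain ⟨e, ε, hS⟩ := exists_isSorted_reorient hM
  rw [← ncard_labelledTypes_of_isSorted hr (reorient_ne_zero e ε hM.1) hS hB,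
    labelledTypes_reorient, Set.ncard_image_of_injective]
  intro T T' h
  funext i j k
  have := congrFun (congrFun (congrFun h i) (e.symm j)) k
  simp only [Equiv.apply_symm_apply] at this
  exact mul_left_cancel₀ (sign_ne_zero.2 (unit_cast_ne_zero _)) this

/-- The labelled type after relabelling the pieces. -/
def relabel {r q : ℕ} (s : Equiv.Perm (Fin q)) (T : LabelledType r q) : LabelledType r q :=
  fun i j k => T (s i) j (s k)

theorem relabel_relabel {r q : ℕ} (s t : Equiv.Perm (Fin q)) (T : LabelledType r q) :
    relabel s (relabel t T) = relabel (t * s) T := rfl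

theorem unlabelledClass_eq_range {r q : ℕ} (T : LabelledType r q) :
    unlabelledClass T = Set.range fun s => relabel s T := by
  ext T'
  constructor
  · rintro ⟨s, h⟩
    exact ⟨s, funext fun i => funext fun j => funext fun k => (h i j k).symm⟩
  · rintro ⟨s, rfl⟩
    exact ⟨s, fun _ _ _ => rfl⟩

theorem unlabelledClass_relabel {r q : ℕ} (s : Equiv.Perm (Fin q)) (T : LabelledType r q) :
    unlabelledClass (relabel s T) = unlabelledClass T := by
  simp only [unlabelledClass_eq_range, relabel_relabel]
  exact (Equiv.mulLeft s).surjective.range_comp fun t => relabel t T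

theorem unlabelledClass_eq_iff {r q : ℕ} (T T' : LabelledType r q) :
    unlabelledClass T' = unlabelledClass T ↔ T' ∈ unlabelledClass T := by
  constructor
  · intro h
    rw [← h]
    exact ⟨1, fun _ _ _ => rfl⟩
  · intro h
    rw [unlabelledClass_eq_range T] at h
    obtain ⟨s, rfl⟩ := h
    exact unlabelledClass_relabel s T

theorem relabel_mem_labelledTypes {r q : ℕ} {M : Fin r → ℝ × ℝ} {B : Set (ℝ × ℝ)}
    (s : Equiv.Perm (Fin q)) {T : LabelledType r q} (hT : T ∈ labelledTypes M B q) :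
    relabel s T ∈ labelledTypes M B q := by
  obtain ⟨n, p, hp, hn, rfl⟩ := hT
  exact ⟨n, p ∘ s, fun i => hp _, fun i k h => hn _ _ (s.injective.ne h), rfl⟩

/-- No nontrivial relabelling of three pieces fixes their labelled type. -/
theorem relabel_injective {r : ℕ} (hr : 1 ≤ r) {T : LabelledType r 3}
    (hT : ∀ i j k, T k j i = -T i j k) {S : Set (Fin r → SignType)}
    (hS : ∀ α ∈ S, ∀ j, α j ≠ 0) (hb : cyclicRows T ∈ balancedTriples S) :
    Function.Injective fun s : Equiv.Perm (Fin 3) => relabel s T := by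
  have main : ∀ s : Equiv.Perm (Fin 3), relabel s T = T → s = 1 := by
    intro s hs
    let j : Fin r := ⟨0, hr⟩
    have h : ∀ i k, T (s i) j (s k) = T i j k := fun i k =>
      congrFun (congrFun (congrFun hs i) j) k
    obtain ⟨h0, h1, h2, hn⟩ := hb
    replace h0 : T 0 j 1 ≠ 0 := hS _ h0 j
    replace h1 : T 1 j 2 ≠ 0 := hS _ h1 j
    replace h2 : T 2 j 0 ≠ 0 := hS _ h2 j
    have hn' : ¬ (T 0 j 1 = T 1 j 2 ∧ T 1 j 2 = T 2 j 0) := hn j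
    let A : SignType → SignType → SignType → Fin 3 → Fin 3 → SignType :=
      fun x y z => ![![0, x, -z], ![-x, 0, y], ![z, -y, 0]]
    -- One move suffices: three nonzero cyclic signs that are not all equal order the pieces
    -- linearly across that move, and only the identity preserves a linear order.
    have key : ∀ (s : Equiv.Perm (Fin 3)) (x y z : SignType), x ≠ 0 → y ≠ 0 → z ≠ 0 →
        ¬ (x = y ∧ y = z) → (∀ i k, A x y z (s i) (s k) = A x y z i k) → s = 1 := by decide
    have diag : ∀ x : SignType, x = -x → x = 0 := by decide
    have hA : ∀ i k, T i j k = A (T 0 j 1) (T 1 j 2) (T 2 j 0) i k := by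
      intro i k
      fin_cases i <;> fin_cases k
      · exact diag _ (hT 0 j 0)
      · rfl
      · exact hT 2 j 0
      · exact hT 0 j 1
      · exact diag _ (hT 1 j 1)
      · rfl
      · rfl
      · exact hT 1 j 2
      · exact diag _ (hT 2 j 2)
    refine key s _ _ _ h0 h1 h2 hn' fun i k => ?_
    rw [← hA, ← hA, h]
  intro s t h
  have : relabel (s * t⁻¹) T = T := by
    have h' : relabel t⁻¹ (relabel s T) = relabel t⁻¹ (relabel t T) := congrArg _ h
    rw [relabel_relabel, relabel_relabel, mul_inv_cancel] at h'
    exact h'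
  exact mul_inv_eq_one.1 (main _ this)

/-- The fibres of `unlabelledClass` are the relabelling orbits, of size `3! = 6` by freeness. -/
theorem ncard_labelledTypes_eq_mul {r : ℕ} (hr : 1 ≤ r) {M : Fin r → ℝ × ℝ}
    {B : Set (ℝ × ℝ)} (hM : ∀ j, M j ≠ 0) (hB : (interior B).Nonempty) :
    (labelledTypes M B 3).ncard = 6 * (unlabelledTypes M B 3).ncard := by
  classical
  have hL : (labelledTypes M B 3).Finite := Set.toFinite _
  have hU : unlabelledTypes M B 3 = (hL.toFinset.image unlabelledClass : Finset _) := by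
    rw [Finset.coe_image, hL.coe_toFinset, unlabelledTypes]
  rw [hU, Set.ncard_coe_finset, Set.ncard_eq_toFinset_card _ hL, mul_comm]
  rw [Finset.card_eq_sum_card_image unlabelledClass hL.toFinset]
  refine Finset.sum_const_nat fun c hc => ?_
  obtain ⟨T, hT, rfl⟩ := Finset.mem_image.1 hc
  rw [hL.mem_toFinset] at hT
  have hi : Function.Injective fun s : Equiv.Perm (Fin 3) => relabel s T := by
    obtain ⟨h1, h2⟩ := (mem_labelledTypes_three_iff hM hB T).1 hT
    refine relabel_injective hr h1 ?_ h2
    rintro _ ⟨v, hv, rfl⟩ j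
    exact sign_ne_zero.2 (hv j)
  have hf : hL.toFinset.filter (fun T' => unlabelledClass T' = unlabelledClass T) =
      Finset.univ.image fun s : Equiv.Perm (Fin 3) => relabel s T := by
    ext T'
    rw [Finset.mem_filter, hL.mem_toFinset, unlabelledClass_eq_iff, unlabelledClass_eq_range T]
    simp only [Finset.mem_image, Finset.mem_univ, true_and, Set.mem_range, and_iff_right_iff_imp]
    rintro ⟨s, rfl⟩
    exact relabel_mem_labelledTypes s hT
  rw [hf, Finset.card_image_of_injective _ hi, Finset.card_univ, Fintype.card_perm,
    Fintype.card_fin]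
  rfl

/-! ### Independence of moves and board, and conclusion -/

theorem labelledTypes_eq_of_isSorted {r : ℕ} (hr : 1 ≤ r) {M M' : Fin r → ℝ × ℝ}
    {B B' : Set (ℝ × ℝ)} (hM : ∀ j, M j ≠ 0) (hM' : ∀ j, M' j ≠ 0) (hS : IsSorted M)
    (hS' : IsSorted M') (hB : (interior B).Nonempty) (hB' : (interior B').Nonempty) :
    labelledTypes M B 3 = labelledTypes M' B' 3 := by
  ext T
  rw [mem_labelledTypes_three_iff hM hB, mem_labelledTypes_three_iff hM' hB',
    signVectors_eq_of_isSorted hr hM hS, signVectors_eq_of_isSorted hr hM' hS']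

theorem theoremT (r : ℕ) (hr : 1 ≤ r) :
    (∀ (M : Fin r → ℝ × ℝ) (B : Set (ℝ × ℝ)), IsMoveSet M → IsBoard B →
      (unlabelledTypes M B 3).Finite ∧
      ((unlabelledTypes M B 3).ncard : ℚ) = (r : ℚ) * ((r : ℚ) ^ 2 + 3 * (r : ℚ) - 1) / 3) ∧
    (∀ (M M' : Fin r → ℝ × ℝ) (B B' : Set (ℝ × ℝ)),
      IsMoveSet M → IsMoveSet M' → IsBoard B → IsBoard B' →
      ∃ (e : Equiv.Perm (Fin r)) (ε : Fin r → ℤˣ),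
        labelledTypes (reorient e ε M) B 3 = labelledTypes M' B' 3 ∧
        unlabelledTypes (reorient e ε M) B 3 = unlabelledTypes M' B' 3) ∧
    (∀ (M M' : Fin r → ℝ × ℝ) (B B' : Set (ℝ × ℝ)),
      IsMoveSet M → IsMoveSet M' → IsSorted M → IsSorted M' → IsBoard B → IsBoard B' →
      labelledTypes M B 3 = labelledTypes M' B' 3 ∧
      unlabelledTypes M B 3 = unlabelledTypes M' B' 3) := by
  refine ⟨fun M B hM hB => ⟨Set.toFinite _, ?_⟩, fun M M' B B' hM hM' hB hB' => ?_,
    fun M M' B B' hM hM' hS hS' hB hB' => ?_⟩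
  · have h1 := ncard_labelledTypes_eq_mul hr hM.1 hB.2
    rw [ncard_labelledTypes hr hM hB.2] at h1
    have h2 : 1 ≤ r ^ 2 + 3 * r := by nlinarith
    have h3 : ((2 * r * (r ^ 2 + 3 * r - 1) : ℕ) : ℚ) =
        ((6 * (unlabelledTypes M B 3).ncard : ℕ) : ℚ) := by rw [h1]
    push_cast [Nat.cast_sub h2] at h3
    linarith
  · obtain ⟨e₁, ε₁, h₁⟩ := exists_isSorted_reorient hM
    obtain ⟨e₂, ε₂, h₂⟩ := exists_isSorted_reorient hM'
    have h := labelledTypes_eq_of_isSorted hr (reorient_ne_zero e₁ ε₁ hM.1)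
      (reorient_ne_zero e₂ ε₂ hM'.1) h₁ h₂ hB.2 hB'.2
    -- Sort `M`, then undo the sorting of `M'`.
    have key : labelledTypes (reorient e₂.symm (fun j => ε₂ (e₂.symm j)) (reorient e₁ ε₁ M)) B 3 =
        labelledTypes M' B' 3 := by
      rw [labelledTypes_reorient, h, ← labelledTypes_reorient, reorient_symm]
    rw [reorient_reorient] at key
    exact ⟨_, _, key, congrArg (unlabelledClass '' ·) key⟩
  · have h := labelledTypes_eq_of_isSorted hr hM.1 hM'.1 hS hS' hB.2 hB'.2
    exact ⟨h, congrArg (unlabelledClass '' ·) h⟩
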